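/- Let $n\ge 0$, let $$S_n=\{x\in\mathbb R^n:\ 0\le x_i\le 1\ (1\le i\le n),\ 0\le x_1+\cdots+x_n\le 1\}$$ be the standard $n$-simplex and $\operatorname{int}S_n$ its interior. A $k$-current on $\operatorname{int}S_n$ is a differential $k$-form $u=\sum_{|I|=k}u_I\,dx^I$ whose coefficients $u_I$ are (real or complex) distributions on $\operatorname{int}S_n$, and its exterior derivative is $du=\sum_{i}dx_i\wedge\partial u/\partial x_i$, the derivatives being taken in the sense of distributions; $u$ is closed if $du=0$. A distribution on $\operatorname{int}S_n$ is called extendible if it is given on $C_c^\infty(\operatorname{int}S_n)$ by a continuous linear functional on the Fréchet space $\dot C^\infty(S_n)=\{\varphi\in C^\infty(\mathbb R^n):\operatorname{supp}\varphi\subset S_n\}$ (densities being identified with functions through $dx$), and a current is called extendible if all its coefficients are. Let $u$ be a closed extendible $k$-current on $\operatorname{int}S_n$. 1. If $k>0$, then there is an extendible $(k-1)$-current $v$ on $\operatorname{int}S_n$ with $u=dv$. 2. If $k=0$, then $u$ is a constant, that is, there is a constant $c$ with $u(\varphi)=c\int\varphi\,dx$ for all $\varphi\in C_c^\infty(\operatorname{int}S_n)$.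 -/

import Mathlib

open MeasureTheory TopologicalSpace Set
open scoped Distributions LineDeriv

noncomputable section

namespace ExtendibleCurrent

/-- The standard simplex `S_n = {x ∈ ℝⁿ ; 0 ≤ x_i ≤ 1, 0 ≤ x_1 + ⋯ + x_n ≤ 1}` as a set. -/
def simplexSet (n : ℕ) : Set (EuclideanSpace ℝ (Fin n)) :=
  {x | (∀ i, 0 ≤ x i ∧ x i ≤ 1) ∧ 0 ≤ ∑ i, x i ∧ ∑ i, x i ≤ 1}

theorem isCompact_simplexSet (n : ℕ) : IsCompact (simplexSet n) := by
  refine Metric.isCompact_of_isClosed_isBounded ?_ ?_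
  · simp only [simplexSet, ofPred_and, ofPred_forall]
    refine IsClosed.inter (isClosed_iInter fun i => IsClosed.inter ?_ ?_) (IsClosed.inter ?_ ?_)
    · exact isClosed_le (by fun_prop) (by fun_prop)
    · exact isClosed_le (by fun_prop) (by fun_prop)
    · exact isClosed_le (by fun_prop) (by fun_prop)
    · exact isClosed_le (by fun_prop) (by fun_prop)
  · refine (Metric.isBounded_iff_subset_closedBall 0).2 ⟨Real.sqrt n, fun x hx => ?_⟩
    rw [mem_closedBall_zero_iff, EuclideanSpace.norm_eq]
    refine Real.sqrt_le_sqrt ?_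
    calc ∑ i, ‖x i‖ ^ 2 ≤ ∑ _i : Fin n, (1 : ℝ) := by
          refine Finset.sum_le_sum fun i _ => ?_
          have h := hx.1 i
          rw [Real.norm_eq_abs, sq_abs]
          nlinarith [h.1, h.2]
      _ = n := by simp

/-- The standard simplex `S_n`, as a compact subset of `ℝⁿ`. -/
def simplex (n : ℕ) : Compacts (EuclideanSpace ℝ (Fin n)) :=
  ⟨simplexSet n, isCompact_simplexSet n⟩

/-- The interior of the standard simplex, as an open subset of `ℝⁿ`. -/
def openSimplex (n : ℕ) : Opens (EuclideanSpace ℝ (Fin n)) :=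
  ⟨interior (simplexSet n), isOpen_interior⟩

/-- The values of `k`-forms on `ℝⁿ` with coefficients in `𝕜`: the space `Λᵏ(ℝⁿ)* ⊗ 𝕜`. -/
abbrev Form (𝕜 : Type*) [RCLike 𝕜] (n k : ℕ) : Type _ :=
  (EuclideanSpace ℝ (Fin n)) [⋀^Fin k]→L[ℝ] 𝕜

/-- A `k`-current on an open set `Ω ⊆ ℝⁿ`: a `k`-form `∑_I u_I dx^I` whose coefficients are
distributions on `Ω`, that is, a distribution on `Ω` with values in the finite-dimensional
space of alternating `k`-forms. Densities on `ℝⁿ` are identified with functions through `dx`. -/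
abbrev Current (𝕜 : Type*) [RCLike 𝕜] {n : ℕ} (Ω : Opens (EuclideanSpace ℝ (Fin n)))
    (k : ℕ) : Type _ :=
  𝓓'(Ω, Form 𝕜 n k)

/-- Left exterior multiplication by the coordinate covector `dx_i`, that is `ω ↦ dx_i ∧ ω`:
`(dx_i ∧ ω)(v_0, …, v_k) = ∑_j (-1)^j (v_j)_i ω(v_0, …, v̂_j, …, v_k)`. -/
def dxWedge (𝕜 : Type*) [RCLike 𝕜] {n : ℕ} (k : ℕ) (i : Fin n) :
    Form 𝕜 n k →L[ℝ] Form 𝕜 n (k + 1) :=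
  (ContinuousAlternatingMap.alternatizeUncurryFinCLM ℝ (EuclideanSpace ℝ (Fin n)) 𝕜).comp
    (ContinuousLinearMap.smulRightL ℝ (EuclideanSpace ℝ (Fin n)) (Form 𝕜 n k)
      (EuclideanSpace.proj i))

/-- The exterior derivative of a current, `du = ∑_i dx_i ∧ ∂u/∂x_i`, with the partial derivatives
taken in the sense of distributions. -/
def extDeriv {𝕜 : Type*} [RCLike 𝕜] {n : ℕ} {Ω : Opens (EuclideanSpace ℝ (Fin n))} {k : ℕ}
    (u : Current 𝕜 Ω k) : Current 𝕜 Ω (k + 1) :=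
  ∑ i : Fin n, Distribution.mapCLM (dxWedge 𝕜 k i) (∂_{EuclideanSpace.single i (1 : ℝ)} u)

/-- A test function on the interior of the simplex, viewed as an element of the space of all
smooth functions on `ℝⁿ` with support in the closed simplex. -/
def toSupportedIn {n : ℕ} (φ : 𝓓(openSimplex n, ℝ)) :
    𝓓_{simplex n}(EuclideanSpace ℝ (Fin n), ℝ) where
  toFun := φ
  contDiff' := φ.contDiff
  zero_on_compl' := fun _ hx => image_eq_zero_of_notMem_tsupport fun h =>
    hx (interior_subset (φ.tsupport_subset h))

/-- A current on the interior of the simplex is extendible if its coefficients are extendible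
distributions, that is, if it is given by a continuous linear functional on the Fréchet space
of smooth functions on `ℝⁿ` with support in the closed simplex. -/
def IsExtendible {𝕜 : Type*} [RCLike 𝕜] {n k : ℕ} (u : Current 𝕜 (openSimplex n) k) : Prop :=
  ∃ T : 𝓓_{simplex n}(EuclideanSpace ℝ (Fin n), ℝ) →L[ℝ] Form 𝕜 n k,
    ∀ φ : 𝓓(openSimplex n, ℝ), u φ = T (toSupportedIn φ)

/-- A `0`-current is a constant if it is the distribution `φ ↦ c ∫ φ dx` of a constant
function `c`. -/
def IsConstant {𝕜 : Type*} [RCLike 𝕜] {n : ℕ} {Ω : Opens (EuclideanSpace ℝ (Fin n))}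
    (u : Current 𝕜 Ω 0) : Prop :=
  ∃ c : 𝕜, ∀ φ : 𝓓(Ω, ℝ),
    u φ = (∫ x, φ x) • ContinuousAlternatingMap.constOfIsEmpty ℝ _ (Fin 0) c

end ExtendibleCurrent

end

/-! This is the Poincaré lemma by a chain homotopy, with every operator transposed onto test
functions. The current `u` is given by a functional `T` on smooth functions supported in the closed
simplex, so an operator continuous on that Fréchet space yields an extendible current when composed
with `T`.

Contracting the simplex to one point `a` transposes to dilations `f(a + (y - a) / s)`, which are
unbounded as `s → 0`. The remedy is to average over `a` with a bump `θ` of integral one and to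
contract in two legs. For `1/2 ≤ s ≤ 1` the map is `x ↦ a + s (x - a)`, with `s = e^{-τ}` and `0 ≤ τ
≤ log 2`. For `0 ≤ s ≤ 1/2` it is `x ↦ s (x - c) + (a + c) / 2`. The legs agree at `s = 1/2`. On the
second leg, using `x` instead of `a` as integration variable has constant Jacobian `2^n` and puts
all `y`-derivatives on `θ`. All these maps take convex combinations of `x`, `a`, `c`, so supports
stay in any convex set containing `c` and the supports of `θ` and `f`. This is needed twice: in the
closed simplex for continuity, and in a compact part of the interior because closedness of `u` can
be tested only there.

Contraction with the velocity gives components `H_{m,i}` (`homotopyOp`), and `J_m` is `scalingOp`.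
They satisfy `∂_j H_{m+1,i} = δ_ij J_m + H_{m,i} ∂_j` and, by the fundamental theorem of calculus in
`s`, `(m+1) J_m f - ∑ ∂_i H_{m+1,i} f = f`. Together with `ι_i (dx_j ∧ η) = δ_ij η - dx_j ∧ ι_i η`
they show that `V = ∑ ι_i ∘ T ∘ H_{k,i}` is a primitive. In degree zero the endpoint `s = 0`
survives and gives the constant. -/

namespace ExtendibleCurrent

open scoped ContDiff

/-! ### Smoothness and derivative bounds for integrals over a compact parameter set. -/

section ParametricIntegral

theorem integrableOn_section {Z E F : Type*} [TopologicalSpace Z] [MeasurableSpace Z]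
    [OpensMeasurableSpace Z] [T2Space Z] [PseudoMetrizableSpace Z] [TopologicalSpace E]
    [NormedAddCommGroup F] {μ : Measure Z} [IsFiniteMeasureOnCompacts μ] {κ : Set Z}
    (hκ : IsCompact κ) {G : Z → E → F} (hG : Continuous (Function.uncurry G)) (y : E) :
    IntegrableOn (fun z => G z y) κ μ :=
  ContinuousOn.integrableOn_compact hκ
    (hG.comp (by fun_prop : Continuous fun z : Z => (z, y))).continuousOn

variable {Z E F : Type} [NormedAddCommGroup Z] [NormedSpace ℝ Z] [NormedAddCommGroup E]
  [NormedSpace ℝ E] [NormedAddCommGroup F] [NormedSpace ℝ F]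

theorem contDiff_uncurry_fderiv {G : Z → E → F} (hG : ContDiff ℝ ∞ (Function.uncurry G)) :
    ContDiff ℝ ∞ (Function.uncurry fun z y => fderiv ℝ (G z) y) := by
  have h : (Function.uncurry fun z y => fderiv ℝ (G z) y) =
      fun p : Z × E => fderiv ℝ (G p.1) p.2 := rfl
  rw [h]
  exact ContDiff.fderiv (f := fun (p : Z × E) y => G p.1 y) (m := ∞) (n := ∞)
    (hG.comp (by fun_prop : ContDiff ℝ ∞ fun q : (Z × E) × E => (q.1.1, q.2)))
    contDiff_snd (by simp)

variable [MeasurableSpace Z] [BorelSpace Z] [FiniteDimensional ℝ E]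
  {μ : Measure Z} [IsFiniteMeasureOnCompacts μ] {κ : Set Z}

theorem hasFDerivAt_setIntegral_of_contDiff (hκ : IsCompact κ) {G : Z → E → F}
    (hG : ContDiff ℝ ∞ (Function.uncurry G)) (y : E) :
    HasFDerivAt (fun y => ∫ z in κ, G z y ∂μ) (∫ z in κ, fderiv ℝ (G z) y ∂μ) y := by
  have hG' := (contDiff_uncurry_fderiv hG).continuous
  obtain ⟨B, hB⟩ := (hκ.prod (isCompact_closedBall y 1)).exists_bound_of_continuousOn
    hG'.continuousOn
  refine hasFDerivAt_integral_of_dominated_of_fderiv_le (bound := fun _ => B)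
    (F' := fun y z => fderiv ℝ (G z) y) (Metric.closedBall_mem_nhds y one_pos)
    (Filter.Eventually.of_forall fun x =>
      (integrableOn_section hκ hG.continuous x).aestronglyMeasurable)
    (integrableOn_section hκ hG.continuous y)
    (integrableOn_section hκ hG' y).aestronglyMeasurable ?_ ?_ ?_
  · filter_upwards [ae_restrict_mem hκ.measurableSet] with z hz x hx
    exact hB (z, x) ⟨hz, hx⟩
  · exact integrableOn_const hκ.measure_lt_top.ne
  · refine Filter.Eventually.of_forall fun z x _ => ?_
    have : ContDiff ℝ ∞ (G z) :=
      hG.comp (by fun_prop : ContDiff ℝ ∞ fun y : E => (z, y))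
    exact (this.differentiable (by simp) x).hasFDerivAt

theorem fderiv_setIntegral_of_contDiff (hκ : IsCompact κ) {G : Z → E → F}
    (hG : ContDiff ℝ ∞ (Function.uncurry G)) :
    fderiv ℝ (fun y => ∫ z in κ, G z y ∂μ) = fun y => ∫ z in κ, fderiv ℝ (G z) y ∂μ :=
  funext fun y => (hasFDerivAt_setIntegral_of_contDiff hκ hG y).fderiv

theorem contDiff_setIntegral (hκ : IsCompact κ) {G : Z → E → F}
    (hG : ContDiff ℝ ∞ (Function.uncurry G)) :
    ContDiff ℝ ∞ (fun y => ∫ z in κ, G z y ∂μ) := by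
  refine contDiff_infty.2 fun N => ?_
  induction N generalizing F with
  | zero =>
    refine contDiff_zero.2 (continuous_iff_continuousAt.2 fun y => ?_)
    exact (hasFDerivAt_setIntegral_of_contDiff hκ hG y).continuousAt
  | succ N ih =>
    push_cast
    refine contDiff_succ_iff_fderiv.2
      ⟨fun y => (hasFDerivAt_setIntegral_of_contDiff hκ hG y).differentiableAt, by simp, ?_⟩
    rw [fderiv_setIntegral_of_contDiff hκ hG]
    exact ih (contDiff_uncurry_fderiv hG)

/-- Supplies the seminorm estimates behind the continuity of the two integral operators. -/
theorem norm_iteratedFDeriv_setIntegral_le (hκ : IsCompact κ) {G : Z → E → F}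
    (hG : ContDiff ℝ ∞ (Function.uncurry G)) {i : ℕ} {B : ℝ}
    (hB : ∀ z ∈ κ, ∀ y, ‖iteratedFDeriv ℝ i (G z) y‖ ≤ B) (y : E) :
    ‖iteratedFDeriv ℝ i (fun y => ∫ z in κ, G z y ∂μ) y‖ ≤ B * μ.real κ := by
  induction i generalizing F with
  | zero =>
    simp only [norm_iteratedFDeriv_zero] at hB ⊢
    exact norm_setIntegral_le_of_norm_le_const hκ.measure_lt_top fun z hz => hB z hz y
  | succ i ih =>
    rw [← norm_iteratedFDeriv_fderiv, fderiv_setIntegral_of_contDiff hκ hG]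
    refine ih (contDiff_uncurry_fderiv hG) fun z hz y => ?_
    rw [norm_iteratedFDeriv_fderiv]
    exact hB z hz y

theorem fderiv_setIntegral_apply (hκ : IsCompact κ) {G : Z → E → F} [CompleteSpace F]
    (hG : ContDiff ℝ ∞ (Function.uncurry G)) (y v : E) :
    fderiv ℝ (fun y => ∫ z in κ, G z y ∂μ) y v = ∫ z in κ, fderiv ℝ (G z) y v ∂μ := by
  rw [fderiv_setIntegral_of_contDiff hκ hG, ContinuousLinearMap.integral_apply]
  exact integrableOn_section hκ (contDiff_uncurry_fderiv hG).continuous y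

end ParametricIntegral

/-! ### The dilation and smoothing operators on functions supported in a convex compact set. -/

section Operators

variable {n : ℕ} {K : Compacts (EuclideanSpace ℝ (Fin n))}

theorem norm_iteratedFDeriv_smul_comp_affine {f : EuclideanSpace ℝ (Fin n) → ℝ}
    (hf : ContDiff ℝ ∞ f) (r t : ℝ) (b : EuclideanSpace ℝ (Fin n)) (i : ℕ)
    (y : EuclideanSpace ℝ (Fin n)) :
    ‖iteratedFDeriv ℝ i (fun y => r • f (t • y + b)) y‖ =
      |r| * (|t| ^ i * ‖iteratedFDeriv ℝ i f (t • y + b)‖) := by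
  have h1 : ContDiff ℝ i (fun z => f (z + b)) :=
    (hf.of_le (by exact_mod_cast le_top)).comp (by fun_prop)
  have h2 : ContDiff ℝ i (fun y => f (t • y + b)) :=
    (hf.of_le (by exact_mod_cast le_top)).comp (by fun_prop)
  rw [iteratedFDeriv_const_smul_apply' h2.contDiffAt,
    iteratedFDeriv_comp_const_smul (f := fun z => f (z + b)) t h1,
    norm_smul, norm_smul, iteratedFDeriv_comp_add_right, norm_pow, Real.norm_eq_abs,
    Real.norm_eq_abs]

/-- The parameter set `K × [0, T]` over which the homotopy operators integrate. -/
def paramSet (K : Compacts (EuclideanSpace ℝ (Fin n))) (T : ℝ) :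
    Set (EuclideanSpace ℝ (Fin n) × ℝ) :=
  (K : Set (EuclideanSpace ℝ (Fin n))) ×ˢ Icc 0 T

theorem isCompact_paramSet (T : ℝ) : IsCompact (paramSet K T) :=
  K.isCompact.prod isCompact_Icc

/-- The integrand `w(a) e^{βτ} f(a + e^τ (y - a))`. -/
noncomputable def dilationKernel (β : ℝ) (w f : EuclideanSpace ℝ (Fin n) → ℝ)
    (z : EuclideanSpace ℝ (Fin n) × ℝ) (y : EuclideanSpace ℝ (Fin n)) : ℝ :=
  (w z.1 * Real.exp (β * z.2)) • f (Real.exp z.2 • y + (1 - Real.exp z.2) • z.1)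

/-- The integrand `s^m f(x) 2ⁿ θ(2(y - s(x - c)) - c)`. -/
noncomputable def smoothingKernel (c : EuclideanSpace ℝ (Fin n)) (m : ℕ)
    (θ f : EuclideanSpace ℝ (Fin n) → ℝ) (z : EuclideanSpace ℝ (Fin n) × ℝ) (y : EuclideanSpace ℝ (Fin n)) : ℝ :=
  (z.2 ^ m * f z.1 * 2 ^ n) • θ ((2 : ℝ) • y + (-((2 * z.2) • (z.1 - c)) - c))

theorem contDiff_dilationKernel (β : ℝ) {w f : EuclideanSpace ℝ (Fin n) → ℝ}
    (hw : ContDiff ℝ ∞ w) (hf : ContDiff ℝ ∞ f) :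
    ContDiff ℝ ∞ (Function.uncurry (dilationKernel β w f)) := by
  unfold dilationKernel Function.uncurry
  fun_prop

theorem contDiff_smoothingKernel (c : EuclideanSpace ℝ (Fin n)) (m : ℕ)
    {θ f : EuclideanSpace ℝ (Fin n) → ℝ} (hθ : ContDiff ℝ ∞ θ) (hf : ContDiff ℝ ∞ f) :
    ContDiff ℝ ∞ (Function.uncurry (smoothingKernel c m θ f)) := by
  unfold smoothingKernel Function.uncurry
  fun_prop

/-- If `x = a + e^τ (y - a)`, then `y = e^{-τ} x + (1 - e^{-τ}) a` is a convex combination of `x`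
and `a` for `τ ≥ 0`. -/
theorem dilationKernel_eq_zero (β : ℝ) {w f : EuclideanSpace ℝ (Fin n) → ℝ}
    {C : Set (EuclideanSpace ℝ (Fin n))} (hC : Convex ℝ C) (hf : ∀ x ∉ C, f x = 0)
    {z : EuclideanSpace ℝ (Fin n) × ℝ} (hw : z.1 ∉ C → w z.1 = 0) (hz : 0 ≤ z.2)
    {y : EuclideanSpace ℝ (Fin n)} (hy : y ∉ C) : dilationKernel β w f z y = 0 := by
  unfold dilationKernel
  by_cases ha : z.1 ∈ C
  · rw [hf, smul_zero]
    intro hx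
    refine hy ?_
    have h1 : Real.exp (-z.2) ≤ 1 := Real.exp_le_one_iff.2 (by linarith)
    have h2 : Real.exp (-z.2) * Real.exp z.2 = 1 := by rw [← Real.exp_add]; simp
    have := hC hx ha (Real.exp_nonneg (-z.2)) (sub_nonneg.2 h1) (by ring)
    rw [smul_add, smul_smul, smul_smul, h2, one_smul, mul_sub, h2, add_assoc, ← add_smul] at this
    simpa using this
  · rw [hw ha]; simp

/-- With `a` the argument of `θ`, `y` is the midpoint of `a` and `2s x + (1 - 2s) c`, which is a
convex combination for `0 ≤ s ≤ 1/2`. -/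
theorem smoothingKernel_eq_zero {c : EuclideanSpace ℝ (Fin n)} (m : ℕ)
    {θ f : EuclideanSpace ℝ (Fin n) → ℝ} {C : Set (EuclideanSpace ℝ (Fin n))} (hC : Convex ℝ C)
    (hc : c ∈ C) (hθ : ∀ x ∉ C, θ x = 0) {z : EuclideanSpace ℝ (Fin n) × ℝ}
    (hf : z.1 ∉ C → f z.1 = 0) (hz : z.2 ∈ Icc (0 : ℝ) (1 / 2))
    {y : EuclideanSpace ℝ (Fin n)} (hy : y ∉ C) : smoothingKernel c m θ f z y = 0 := by
  unfold smoothingKernel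
  by_cases hx : z.1 ∈ C
  · rw [hθ, smul_zero]
    intro ha
    refine hy ?_
    have h1 := hC hx hc (by linarith [hz.1] : 0 ≤ 2 * z.2) (by linarith [hz.2] : 0 ≤ 1 - 2 * z.2)
      (by ring)
    have h2 := hC h1 ha (by norm_num : (0 : ℝ) ≤ 1 / 2) (by norm_num : (0 : ℝ) ≤ 1 / 2)
      (by norm_num)
    convert h2 using 1
    module
  · rw [hf hx]; simp

/-- The operator `f ↦ ∫ w(a) e^{βτ} f(a + e^τ (· - a)) da dτ` on smooth functions supported in a
convex compact set, the integral being taken over `K × [0, log 2]`. -/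
noncomputable def dilationOp (hK : Convex ℝ (K : Set (EuclideanSpace ℝ (Fin n)))) (β : ℝ)
    (w : 𝓓_{K}(EuclideanSpace ℝ (Fin n), ℝ)) :
    𝓓_{K}(EuclideanSpace ℝ (Fin n), ℝ) →L[ℝ] 𝓓_{K}(EuclideanSpace ℝ (Fin n), ℝ) :=
  ContDiffMapSupportedIn.mkCLM ℝ
    (fun f y => ∫ z in paramSet K (Real.log 2), dilationKernel β w f z y)
    (fun f g y => by
      rw [← integral_add
        (integrableOn_section (isCompact_paramSet _)
          (contDiff_dilationKernel β w.contDiff f.contDiff).continuous y)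
        (integrableOn_section (isCompact_paramSet _)
          (contDiff_dilationKernel β w.contDiff g.contDiff).continuous y)]
      simp [dilationKernel, mul_add])
    (fun r f y => by
      rw [← integral_smul]
      simp only [dilationKernel, smul_apply, smul_comm r])
    (fun f => contDiff_setIntegral (isCompact_paramSet _)
      (contDiff_dilationKernel β w.contDiff f.contDiff))
    (fun f y hy => setIntegral_eq_zero_of_forall_eq_zero fun z hz =>
      dilationKernel_eq_zero β hK f.zero_on_compl (fun h => absurd hz.1 h) hz.2.1 hy)
    (fun i _ => by
      -- Each `y`-derivative falls on `f` and costs a factor `e^τ`, bounded because `τ ≤ log 2`.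
      obtain ⟨B, hB⟩ := (isCompact_paramSet (K := K) (Real.log 2)).exists_bound_of_continuousOn
        (f := fun z => |w z.1 * Real.exp (β * z.2)| * |Real.exp z.2| ^ i)
        (by have := w.contDiff.continuous; fun_prop)
      refine ⟨{i}, |B| * volume.real (paramSet K (Real.log 2)), by positivity, fun f y _ => ?_⟩
      rw [Finset.sup_singleton, mul_right_comm]
      refine norm_iteratedFDeriv_setIntegral_le (isCompact_paramSet _)
        (contDiff_dilationKernel β w.contDiff f.contDiff) (fun z hz y => ?_) y
      unfold dilationKernel
      rw [norm_iteratedFDeriv_smul_comp_affine f.contDiff, ← mul_assoc]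
      refine mul_le_mul ?_
        (ContDiffMapSupportedIn.norm_iteratedFDeriv_apply_le_seminorm_top ℝ) (norm_nonneg _)
        (abs_nonneg _)
      exact (Real.le_norm_self _).trans ((hB z hz).trans (le_abs_self B)))

/-- The operator `f ↦ ∫ s^m f(x) 2ⁿ θ(2(· - s(x - c)) - c) dx ds` on smooth functions supported in
a convex compact set, the integral being taken over `K × [0, 1/2]`. -/
noncomputable def smoothingOp (hK : Convex ℝ (K : Set (EuclideanSpace ℝ (Fin n))))
    {c : EuclideanSpace ℝ (Fin n)} (hc : c ∈ K) (m : ℕ)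
    (θ : 𝓓_{K}(EuclideanSpace ℝ (Fin n), ℝ)) :
    𝓓_{K}(EuclideanSpace ℝ (Fin n), ℝ) →L[ℝ] 𝓓_{K}(EuclideanSpace ℝ (Fin n), ℝ) :=
  ContDiffMapSupportedIn.mkCLM ℝ
    (fun f y => ∫ z in paramSet K (1 / 2), smoothingKernel c m θ f z y)
    (fun f g y => by
      rw [← integral_add
        (integrableOn_section (isCompact_paramSet _)
          (contDiff_smoothingKernel c m θ.contDiff f.contDiff).continuous y)
        (integrableOn_section (isCompact_paramSet _)
          (contDiff_smoothingKernel c m θ.contDiff g.contDiff).continuous y)]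
      simp [smoothingKernel, mul_add, add_mul])
    (fun r f y => by
      rw [← integral_smul]
      refine integral_congr_ae (Filter.Eventually.of_forall fun z => ?_)
      simp only [smoothingKernel, smul_apply, smul_eq_mul]
      ring)
    (fun f => contDiff_setIntegral (isCompact_paramSet _)
      (contDiff_smoothingKernel c m θ.contDiff f.contDiff))
    (fun f y hy => setIntegral_eq_zero_of_forall_eq_zero fun z hz =>
      smoothingKernel_eq_zero m hK hc θ.zero_on_compl (fun h => absurd hz.1 h) hz.2 hy)
    (fun i _ => by
      -- The `y`-derivatives fall on `θ`, so the sup norm of `f` controls every order.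
      refine ⟨{0}, (1 * 2 ^ n * (2 ^ i * ContDiffMapSupportedIn.seminorm ℝ _ _ ⊤ K i θ)) *
        volume.real (paramSet K (1 / 2)), by positivity, fun f y _ => ?_⟩
      rw [Finset.sup_singleton, mul_right_comm]
      refine norm_iteratedFDeriv_setIntegral_le (isCompact_paramSet _)
        (contDiff_smoothingKernel c m θ.contDiff f.contDiff) (fun z hz y => ?_) y
      unfold smoothingKernel
      rw [norm_iteratedFDeriv_smul_comp_affine θ.contDiff, abs_mul, abs_mul, abs_pow,
        abs_of_nonneg hz.2.1, abs_of_pos (by positivity : (0 : ℝ) < 2 ^ n),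
        abs_of_pos (zero_lt_two' ℝ), mul_right_comm (1 * 2 ^ n), mul_right_comm 1]
      gcongr
      · exact pow_le_one₀ hz.2.1 (hz.2.2.trans (by norm_num))
      · exact ContDiffMapSupportedIn.norm_apply_le_seminorm ℝ (f := f)
      · exact ContDiffMapSupportedIn.norm_iteratedFDeriv_apply_le_seminorm_top ℝ)

/-- The directional derivative of smooth functions supported in `K`. -/
noncomputable def dirDeriv (v : EuclideanSpace ℝ (Fin n)) :
    𝓓_{K}(EuclideanSpace ℝ (Fin n), ℝ) →L[ℝ] 𝓓_{K}(EuclideanSpace ℝ (Fin n), ℝ) :=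
  (ContDiffMapSupportedIn.postcompCLM (ContinuousLinearMap.apply ℝ ℝ v)).comp
    (ContDiffMapSupportedIn.fderivCLM ℝ ⊤ ⊤)

/-- Multiplication by the coordinate function `x ↦ x_i - c_i`. -/
noncomputable def coordMul (c : EuclideanSpace ℝ (Fin n)) (i : Fin n) :
    𝓓_{K}(EuclideanSpace ℝ (Fin n), ℝ) →L[ℝ] 𝓓_{K}(EuclideanSpace ℝ (Fin n), ℝ) :=
  ContDiffMapSupportedIn.bilinLeftCLM (ContinuousLinearMap.mul ℝ ℝ)
    (g := fun x : EuclideanSpace ℝ (Fin n) => x i - c i) (by fun_prop)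

theorem dilationOp_apply (hK : Convex ℝ (K : Set (EuclideanSpace ℝ (Fin n)))) (β : ℝ)
    (w f : 𝓓_{K}(EuclideanSpace ℝ (Fin n), ℝ)) (y : EuclideanSpace ℝ (Fin n)) :
    dilationOp hK β w f y = ∫ z in paramSet K (Real.log 2), dilationKernel β w f z y :=
  rfl

theorem smoothingOp_apply (hK : Convex ℝ (K : Set (EuclideanSpace ℝ (Fin n))))
    {c : EuclideanSpace ℝ (Fin n)} (hc : c ∈ K) (m : ℕ)
    (θ f : 𝓓_{K}(EuclideanSpace ℝ (Fin n), ℝ)) (y : EuclideanSpace ℝ (Fin n)) :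
    smoothingOp hK hc m θ f y = ∫ z in paramSet K (1 / 2), smoothingKernel c m θ f z y :=
  rfl

theorem dirDeriv_apply (v : EuclideanSpace ℝ (Fin n)) (f : 𝓓_{K}(EuclideanSpace ℝ (Fin n), ℝ))
    (y : EuclideanSpace ℝ (Fin n)) : dirDeriv v f y = fderiv ℝ f y v := by
  simp [dirDeriv]

theorem coordMul_apply (c : EuclideanSpace ℝ (Fin n)) (i : Fin n)
    (f : 𝓓_{K}(EuclideanSpace ℝ (Fin n), ℝ)) (y : EuclideanSpace ℝ (Fin n)) :
    coordMul c i f y = f y * (y i - c i) :=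
  rfl

end Operators

/-! ### Derivatives of the operators and their endpoint formulas. -/

section Identities

variable {n : ℕ} {K : Compacts (EuclideanSpace ℝ (Fin n))}

theorem setIntegral_paramSet {G : EuclideanSpace ℝ (Fin n) × ℝ → ℝ} (hG : Continuous G) {T : ℝ}
    (hT : 0 ≤ T) :
    ∫ z in paramSet K T, G z = ∫ a in (K : Set (EuclideanSpace ℝ (Fin n))), ∫ t in 0..T,
      G (a, t) := by
  have h : IntegrableOn G (paramSet K T) :=
    hG.continuousOn.integrableOn_compact (isCompact_paramSet T)
  rw [paramSet, Measure.volume_eq_prod, setIntegral_prod _ h]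
  simp only [intervalIntegral.integral_of_le hT, integral_Icc_eq_integral_Ioc]

theorem setIntegral_paramSet_symm {G : EuclideanSpace ℝ (Fin n) × ℝ → ℝ} (hG : Continuous G)
    {T : ℝ} :
    ∫ z in paramSet K T, G z = ∫ t in Icc 0 T, ∫ a in (K : Set (EuclideanSpace ℝ (Fin n))),
      G (a, t) := by
  have h : IntegrableOn G (paramSet K T) :=
    hG.continuousOn.integrableOn_compact (isCompact_paramSet T)
  rw [IntegrableOn, paramSet, Measure.volume_eq_prod, ← Measure.prod_restrict] at h
  rw [paramSet, Measure.volume_eq_prod, ← Measure.prod_restrict, integral_prod_symm _ h]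

theorem sum_mul_apply_single (L : EuclideanSpace ℝ (Fin n) →L[ℝ] ℝ)
    (v : EuclideanSpace ℝ (Fin n)) : ∑ i, v i * L (EuclideanSpace.single i 1) = L v := by
  conv_rhs => rw [← (EuclideanSpace.basisFun (Fin n) ℝ).sum_repr v]
  simp

theorem differentiable_coe (f : 𝓓_{K}(EuclideanSpace ℝ (Fin n), ℝ)) : Differentiable ℝ f :=
  f.contDiff.differentiable (by simp)

theorem continuous_coe (f : 𝓓_{K}(EuclideanSpace ℝ (Fin n), ℝ)) : Continuous f :=
  f.contDiff.continuous

theorem dirDeriv_coordMul (c : EuclideanSpace ℝ (Fin n)) (i j : Fin n)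
    (f : 𝓓_{K}(EuclideanSpace ℝ (Fin n), ℝ)) :
    dirDeriv (EuclideanSpace.single j 1) (coordMul c i f) =
      (if i = j then f else 0) + coordMul c i (dirDeriv (EuclideanSpace.single j 1) f) := by
  ext y
  rw [dirDeriv_apply, add_apply, coordMul_apply, dirDeriv_apply]
  have h : HasFDerivAt (fun x : EuclideanSpace ℝ (Fin n) => x i - c i)
      (EuclideanSpace.proj i : EuclideanSpace ℝ (Fin n) →L[ℝ] ℝ) y :=
    (EuclideanSpace.proj i : EuclideanSpace ℝ (Fin n) →L[ℝ] ℝ).hasFDerivAt.sub_const _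
  have h2 := ((differentiable_coe f y).hasFDerivAt.mul h).fderiv
  have h3 : (coordMul c i f : EuclideanSpace ℝ (Fin n) → ℝ) = ⇑f * fun x => x i - c i := rfl
  rw [h3, h2]
  by_cases hij : i = j
  · subst hij; simp; ring
  · simp [hij]; ring

theorem fderiv_smul_comp_affine_apply (f : 𝓓_{K}(EuclideanSpace ℝ (Fin n), ℝ)) (t : ℝ)
    (b y v : EuclideanSpace ℝ (Fin n)) (r : ℝ) :
    fderiv ℝ (fun y => r • f (t • y + b)) y v = r * (t * fderiv ℝ f (t • y + b) v) := by
  have h1 : HasFDerivAt (fun y : EuclideanSpace ℝ (Fin n) => t • y + b)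
      (t • ContinuousLinearMap.id ℝ _) y :=
    ((hasFDerivAt_id y).const_smul t).add_const b
  have h2 := ((differentiable_coe f (t • y + b)).hasFDerivAt.comp y h1).const_smul r
  have h3 := h2.fderiv
  rw [show (fun y => r • f (t • y + b)) = r • (⇑f ∘ fun y => t • y + b) from rfl, h3]
  simp

theorem dirDeriv_dilationOp (hK : Convex ℝ (K : Set (EuclideanSpace ℝ (Fin n)))) (β : ℝ)
    (w f : 𝓓_{K}(EuclideanSpace ℝ (Fin n), ℝ)) (v : EuclideanSpace ℝ (Fin n)) :
    dirDeriv v (dilationOp hK β w f) = dilationOp hK (β + 1) w (dirDeriv v f) := by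
  ext y
  rw [dirDeriv_apply, dilationOp_apply]
  refine (fderiv_setIntegral_apply (isCompact_paramSet _)
    (contDiff_dilationKernel β w.contDiff f.contDiff) y v).trans ?_
  refine integral_congr_ae (Filter.Eventually.of_forall fun z => ?_)
  simp only [dilationKernel, dirDeriv_apply]
  rw [show (fderiv ℝ (dilationKernel β w f z) y) v = _ from
    fderiv_smul_comp_affine_apply f (Real.exp z.2) _ y v _, add_mul, one_mul, Real.exp_add, smul_eq_mul]
  ring

theorem integral_mul_fderiv_comp_affine (f θ : 𝓓_{K}(EuclideanSpace ℝ (Fin n), ℝ))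
    {t : ℝ} (b v : EuclideanSpace ℝ (Fin n)) :
    t * ∫ x in (K : Set (EuclideanSpace ℝ (Fin n))), f x * fderiv ℝ θ (t • x + b) v =
      - ∫ x in (K : Set (EuclideanSpace ℝ (Fin n))), fderiv ℝ f x v * θ (t • x + b) := by
  have hθ' : Continuous fun x => fderiv ℝ θ x v := by
    have := continuous_coe (dirDeriv v θ)
    exact this.congr (dirDeriv_apply v θ)
  have hf' : Continuous fun x => fderiv ℝ f x v :=
    (continuous_coe (dirDeriv v f)).congr (dirDeriv_apply v f)
  have hf0 : ∀ x ∉ (K : Set (EuclideanSpace ℝ (Fin n))), fderiv ℝ f x v = 0 := fun x hx => by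
    rw [← dirDeriv_apply]; exact (dirDeriv v f).zero_on_compl hx
  have hfs : HasCompactSupport fun x => fderiv ℝ f x v :=
    HasCompactSupport.of_support_subset_isCompact K.isCompact fun x hx => by
      by_contra h; exact hx (hf0 x h)
  have hd : ∀ x, fderiv ℝ (fun x => θ (t • x + b)) x v = t * fderiv ℝ θ (t • x + b) v := fun x => by
    simpa using fderiv_smul_comp_affine_apply θ t b x v 1
  have hdiff : Differentiable ℝ fun x => θ (t • x + b) :=
    (differentiable_coe θ).comp (by fun_prop)
  have hθc := continuous_coe θ
  have hfc := continuous_coe f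
  rw [setIntegral_eq_integral_of_forall_compl_eq_zero
      (fun x hx => by rw [show f x = 0 from f.zero_on_compl hx, zero_mul]),
    setIntegral_eq_integral_of_forall_compl_eq_zero
      (fun x hx => by rw [hf0 x hx, zero_mul]),
    ← integral_mul_fderiv_eq_neg_fderiv_mul_of_integrable (g := fun x => θ (t • x + b)),
    ← integral_const_mul]
  · simp only [hd]; congr 1; ext x; ring
  · exact Continuous.integrable_of_hasCompactSupport (by fun_prop) hfs.mul_right
  · simp only [hd]
    exact Continuous.integrable_of_hasCompactSupport (by fun_prop) f.compact_supp.mul_right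
  · exact Continuous.integrable_of_hasCompactSupport (by fun_prop) f.compact_supp.mul_right
  · exact fun x _ => differentiable_coe f x
  · exact fun x _ => hdiff x

/-- Since `θ` is evaluated at `2y - 2s x + const`, `s ∂_y` acts on it as `-∂_x`; integrating by
parts in `x` moves the derivative to `f` and uses up one power of `s`. -/
theorem dirDeriv_smoothingOp (hK : Convex ℝ (K : Set (EuclideanSpace ℝ (Fin n))))
    {c : EuclideanSpace ℝ (Fin n)} (hc : c ∈ K) (m : ℕ)
    (θ f : 𝓓_{K}(EuclideanSpace ℝ (Fin n), ℝ)) (v : EuclideanSpace ℝ (Fin n)) :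
    dirDeriv v (smoothingOp hK hc (m + 1) θ f) = smoothingOp hK hc m θ (dirDeriv v f) := by
  ext y
  rw [dirDeriv_apply, smoothingOp_apply]
  refine (fderiv_setIntegral_apply (isCompact_paramSet _)
    (contDiff_smoothingKernel c (m + 1) θ.contDiff f.contDiff) y v).trans ?_
  have hc1 : Continuous fun z => fderiv ℝ (smoothingKernel c (m + 1) θ f z) y v :=
    ((contDiff_uncurry_fderiv (contDiff_smoothingKernel c (m + 1) θ.contDiff
      f.contDiff)).continuous.comp (by fun_prop : Continuous fun z => (z, y))).clm_apply
      continuous_const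
  have hc2 : Continuous fun z => smoothingKernel c m θ (dirDeriv v f) z y :=
    (contDiff_smoothingKernel c m θ.contDiff (dirDeriv v f).contDiff).continuous.comp
      (by fun_prop : Continuous fun z => (z, y))
  rw [setIntegral_paramSet_symm hc1, setIntegral_paramSet_symm hc2]
  refine integral_congr_ae (Filter.Eventually.of_forall fun s => ?_)
  have key := integral_mul_fderiv_comp_affine f θ (t := -(2 * s))
    ((2 : ℝ) • y + (2 * s) • c - c) v
  have harg : ∀ x : EuclideanSpace ℝ (Fin n), (2 : ℝ) • y + (-((2 * s) • (x - c)) - c) =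
      (-(2 * s)) • x + ((2 : ℝ) • y + (2 * s) • c - c) := fun x => by module
  have e1 : ∀ x, fderiv ℝ (smoothingKernel c (m + 1) θ f (x, s)) y v = (2 ^ n * s ^ m) *
      ((2 * s) * (f x * fderiv ℝ θ (-(2 * s) • x + ((2 : ℝ) • y + (2 * s) • c - c)) v)) :=
    fun x => by
      rw [← harg, show fderiv ℝ (smoothingKernel c (m + 1) θ f (x, s)) y v = _ from
        fderiv_smul_comp_affine_apply θ 2 _ y v _]
      ring
  have e2 : ∀ x, smoothingKernel c m θ (dirDeriv v f) (x, s) y = (2 ^ n * s ^ m) *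
      (fderiv ℝ f x v * θ (-(2 * s) • x + ((2 : ℝ) • y + (2 * s) • c - c))) := fun x => by
    simp only [smoothingKernel, harg, dirDeriv_apply, smul_eq_mul]
    ring
  simp only [e1, e2, integral_const_mul]
  linear_combination (-(2 ^ n * s ^ m)) * key

/-- The left side integrates the `τ`-derivative of `-θ(a) e^{βτ} f(x)`, where `x = a + e^τ (y - a)`
moves with velocity `x - a = (x - c) - (a - c)`. The divergence of `(x - c) f` produces the term `n
f` that cancels `n`. -/
theorem dilationOp_boundary (hK : Convex ℝ (K : Set (EuclideanSpace ℝ (Fin n)))) (β : ℝ)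
    (c : EuclideanSpace ℝ (Fin n)) (θ f : 𝓓_{K}(EuclideanSpace ℝ (Fin n), ℝ))
    (y : EuclideanSpace ℝ (Fin n)) :
    ((n : ℝ) - β) * dilationOp hK β θ f y
      - ∑ i, dilationOp hK β θ (dirDeriv (EuclideanSpace.single i 1) (coordMul c i f)) y
      + ∑ i, dilationOp hK β (coordMul c i θ) (dirDeriv (EuclideanSpace.single i 1) f) y =
    (∫ a in (K : Set (EuclideanSpace ℝ (Fin n))), θ a) * f y -
      ∫ a in (K : Set (EuclideanSpace ℝ (Fin n))),
        θ a * (Real.exp (β * Real.log 2) * f ((2 : ℝ) • y - a)) := by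
  have hcont : ∀ w g : 𝓓_{K}(EuclideanSpace ℝ (Fin n), ℝ),
      Continuous fun z => dilationKernel β w g z y := fun w g =>
    (contDiff_dilationKernel β w.contDiff g.contDiff).continuous.comp
      (by fun_prop : Continuous fun z => (z, y))
  have hint : ∀ w g : 𝓓_{K}(EuclideanSpace ℝ (Fin n), ℝ),
      IntegrableOn (fun z => dilationKernel β w g z y) (paramSet K (Real.log 2)) := fun w g =>
    integrableOn_section (isCompact_paramSet _)
      (contDiff_dilationKernel β w.contDiff g.contDiff).continuous y
  have hcint := ((hcont θ f).const_mul ((n : ℝ) - β)).sub (continuous_finsetSum Finset.univ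
    fun i _ => hcont θ (dirDeriv (EuclideanSpace.single i 1) (coordMul c i f)))
  rw [Pi.sub_def] at hcint
  simp only [dilationOp_apply]
  rw [← integral_const_mul, ← integral_finsetSum _ fun i _ => hint _ _,
    ← integral_finsetSum _ fun i _ => hint _ _,
    ← integral_sub ((hint _ _).const_mul _) (integrable_finsetSum _ fun i _ => hint _ _),
    ← integral_add (hcint.continuousOn.integrableOn_compact (isCompact_paramSet _))
      (integrable_finsetSum _ fun i _ => hint _ _)]
  rw [setIntegral_paramSet _ (Real.log_nonneg one_le_two)]
  swap
  · exact hcint.add (continuous_finsetSum _ fun i _ => hcont _ _)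
  rw [← integral_mul_const, ← integral_sub]
  rotate_left
  · exact ((continuous_coe θ).mul continuous_const).continuousOn.integrableOn_compact K.isCompact
  · have := continuous_coe θ
    have := continuous_coe f
    exact Continuous.continuousOn (by fun_prop) |>.integrableOn_compact K.isCompact
  refine integral_congr_ae (Filter.Eventually.of_forall fun a => ?_)
  have hd : ∀ τ : ℝ, HasDerivAt
      (fun τ => -(θ a * (Real.exp (β * τ) * f (Real.exp τ • y + (1 - Real.exp τ) • a))))
      (((n : ℝ) - β) * dilationKernel β θ f (a, τ) y
        - ∑ i, dilationKernel β θ (dirDeriv (EuclideanSpace.single i 1) (coordMul c i f)) (a, τ) y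
        + ∑ i, dilationKernel β (coordMul c i θ) (dirDeriv (EuclideanSpace.single i 1) f)
          (a, τ) y) τ := fun τ => by
    set x := Real.exp τ • y + (1 - Real.exp τ) • a with hx
    have h1 : HasDerivAt (fun τ => Real.exp τ • y + (1 - Real.exp τ) • a)
        (Real.exp τ • y + (-Real.exp τ) • a) τ :=
      ((Real.hasDerivAt_exp τ).smul_const y).add
        (((Real.hasDerivAt_exp τ).const_sub 1).smul_const a)
    have h2 : HasDerivAt (fun τ => f (Real.exp τ • y + (1 - Real.exp τ) • a)) _ τ :=
      (differentiable_coe f x).hasFDerivAt.comp_hasDerivAt τ h1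
    have h3 : HasDerivAt (fun τ => Real.exp (β * τ)) (Real.exp (β * τ) * (β * 1)) τ :=
      ((hasDerivAt_id τ).const_mul β).exp
    refine (((h3.mul h2).const_mul (θ a)).neg).congr_deriv ?_
    have hxa : Real.exp τ • y + (-Real.exp τ) • a = x - a := by rw [hx]; module
    rw [hxa, ← sum_mul_apply_single (fderiv ℝ f x) (x - a)]
    simp only [dilationKernel, ← hx, dirDeriv_coordMul, if_true, add_apply, coordMul_apply,
      dirDeriv_apply, smul_eq_mul, mul_add, Finset.sum_add_distrib, Finset.sum_const,
      Finset.card_univ, Fintype.card_fin, nsmul_eq_mul, PiLp.sub_apply]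
    have e : ∑ i, θ a * Real.exp (β * τ) *
          (fderiv ℝ f x (EuclideanSpace.single i 1) * (x i - c i)) -
        ∑ i, θ a * (a i - c i) * Real.exp (β * τ) * fderiv ℝ f x (EuclideanSpace.single i 1) =
        θ a * Real.exp (β * τ) *
          ∑ i, (x i - a i) * fderiv ℝ f x (EuclideanSpace.single i 1) := by
      rw [← Finset.sum_sub_distrib, Finset.mul_sum]
      exact Finset.sum_congr rfl fun i _ => by ring
    linear_combination e
  have hci : Continuous fun τ => (((n : ℝ) - β) * dilationKernel β θ f (a, τ) y
        - ∑ i, dilationKernel β θ (dirDeriv (EuclideanSpace.single i 1) (coordMul c i f)) (a, τ) y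
        + ∑ i, dilationKernel β (coordMul c i θ) (dirDeriv (EuclideanSpace.single i 1) f)
          (a, τ) y) := by
    have hs : ∀ w g : 𝓓_{K}(EuclideanSpace ℝ (Fin n), ℝ),
      Continuous fun τ => dilationKernel β w g (a, τ) y := fun w g =>
        (hcont w g).comp (by fun_prop : Continuous fun τ : ℝ => (a, τ))
    exact (((hs _ _).const_mul _).sub (continuous_finsetSum _ fun i _ => hs _ _)).add
      (continuous_finsetSum _ fun i _ => hs _ _)
  have := intervalIntegral.integral_eq_sub_of_hasDerivAt (fun τ _ => hd τ)
    (hci.intervalIntegrable 0 (Real.log 2))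
  refine this.trans ?_
  have h2 : (2 : ℝ) • y + (1 - 2 : ℝ) • a = (2 : ℝ) • y - a := by module
  rw [Real.exp_log two_pos, h2]
  simp
  ring

/-- The fundamental theorem of calculus in `s` on `[0, 1/2]`. The truncated `m - 1` at `m = 0` is
harmless because of the factor `m`; the `0 ^ m` is the endpoint `s = 0`. -/
theorem smoothingOp_boundary (hK : Convex ℝ (K : Set (EuclideanSpace ℝ (Fin n))))
    {c : EuclideanSpace ℝ (Fin n)} (hc : c ∈ K) (m : ℕ)
    (θ f : 𝓓_{K}(EuclideanSpace ℝ (Fin n), ℝ)) (y : EuclideanSpace ℝ (Fin n)) :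
    (m : ℝ) * smoothingOp hK hc (m - 1) θ f y
      - ∑ i, dirDeriv (EuclideanSpace.single i 1) (smoothingOp hK hc m θ (coordMul c i f)) y =
    ∫ x in (K : Set (EuclideanSpace ℝ (Fin n))),
      f x * 2 ^ n * ((1 / 2) ^ m * θ ((2 : ℝ) • y - x) - 0 ^ m * θ ((2 : ℝ) • y - c)) := by
  have hcont : ∀ (k : ℕ) (g : 𝓓_{K}(EuclideanSpace ℝ (Fin n), ℝ)),
      Continuous fun z => smoothingKernel c k θ g z y := fun k g =>
    (contDiff_smoothingKernel c k θ.contDiff g.contDiff).continuous.comp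
      (by fun_prop : Continuous fun z => (z, y))
  have hcont' : ∀ (k : ℕ) (v) (g : 𝓓_{K}(EuclideanSpace ℝ (Fin n), ℝ)),
      Continuous fun z => fderiv ℝ (smoothingKernel c k θ g z) y v := fun k v g =>
    ((contDiff_uncurry_fderiv (contDiff_smoothingKernel c k θ.contDiff
      g.contDiff)).continuous.comp (by fun_prop : Continuous fun z => (z, y))).clm_apply
      continuous_const
  have hint : ∀ {G : EuclideanSpace ℝ (Fin n) × ℝ → ℝ}, Continuous G →
      IntegrableOn G (paramSet K (1 / 2)) := fun hG =>
    hG.continuousOn.integrableOn_compact (isCompact_paramSet _)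
  have hD : ∀ i, dirDeriv (EuclideanSpace.single i 1)
      (smoothingOp hK hc m θ (coordMul c i f)) y = ∫ z in paramSet K (1 / 2),
        fderiv ℝ (smoothingKernel c m θ (coordMul c i f) z) y (EuclideanSpace.single i 1) :=
    fun i => by
      rw [dirDeriv_apply]
      exact fderiv_setIntegral_apply (isCompact_paramSet _)
        (contDiff_smoothingKernel c m θ.contDiff (coordMul c i f).contDiff) y _
  simp only [hD, smoothingOp_apply]
  rw [← integral_const_mul, ← integral_finsetSum _ fun i _ => hint (hcont' _ _ _),
    ← integral_sub ((hint (hcont _ _)).const_mul _)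
      (integrable_finsetSum _ fun i _ => hint (hcont' _ _ _)),
    setIntegral_paramSet _ (by norm_num)]
  swap
  · exact ((hcont _ _).const_mul _).sub (continuous_finsetSum _ fun i _ => hcont' _ _ _)
  refine integral_congr_ae (Filter.Eventually.of_forall fun x => ?_)
  have hd : ∀ s : ℝ, HasDerivAt
      (fun s => f x * 2 ^ n * (s ^ m * θ ((2 : ℝ) • y + (-((2 * s) • (x - c)) - c))))
      ((m : ℝ) * smoothingKernel c (m - 1) θ f (x, s) y
        - ∑ i, fderiv ℝ (smoothingKernel c m θ (coordMul c i f) (x, s)) y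
            (EuclideanSpace.single i 1)) s := fun s => by
    set z := (2 : ℝ) • y + (-((2 * s) • (x - c)) - c) with hz
    have h1 : HasDerivAt (fun s : ℝ => (2 : ℝ) • y + (-((2 * s) • (x - c)) - c))
        (-((2 * 1 : ℝ) • (x - c))) s :=
      ((((hasDerivAt_id s).const_mul 2).smul_const (x - c)).neg.sub_const c).const_add _
    have h2 : HasDerivAt (fun s : ℝ => θ ((2 : ℝ) • y + (-((2 * s) • (x - c)) - c))) _ s :=
      (differentiable_coe θ z).hasFDerivAt.comp_hasDerivAt s h1
    refine (((hasDerivAt_pow m s).mul h2).const_mul (f x * 2 ^ n)).congr_deriv ?_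
    have e : ∀ i, fderiv ℝ (smoothingKernel c m θ (coordMul c i f) (x, s)) y
        (EuclideanSpace.single i 1) = (2 * s ^ m * f x * 2 ^ n) *
          ((x - c) i * fderiv ℝ θ z (EuclideanSpace.single i 1)) := fun i => by
      rw [show fderiv ℝ (smoothingKernel c m θ (coordMul c i f) (x, s)) y
        (EuclideanSpace.single i 1) = _ from fderiv_smul_comp_affine_apply θ 2 _ y _ _, ← hz,
        coordMul_apply, PiLp.sub_apply]
      ring
    simp only [e, ← Finset.mul_sum, sum_mul_apply_single, smoothingKernel, ← hz, map_neg,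
      map_smul, smul_eq_mul]
    ring
  have hci : Continuous fun s => ((m : ℝ) * smoothingKernel c (m - 1) θ f (x, s) y
        - ∑ i, fderiv ℝ (smoothingKernel c m θ (coordMul c i f) (x, s)) y
            (EuclideanSpace.single i 1)) :=
    (((hcont _ _).const_mul _).sub (continuous_finsetSum _ fun i _ => hcont' _ _ _)).comp
      (by fun_prop : Continuous fun s : ℝ => (x, s))
  refine (intervalIntegral.integral_eq_sub_of_hasDerivAt (fun s _ => hd s)
    (hci.intervalIntegrable 0 (1 / 2))).trans ?_
  have h2 : (2 : ℝ) • y + (-((2 * (1 / 2 : ℝ)) • (x - c)) - c) = (2 : ℝ) • y - x := by module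
  have h3 : (2 : ℝ) • y + (-((2 * (0 : ℝ)) • (x - c)) - c) = (2 : ℝ) • y - c := by module
  rw [h2, h3]
  ring

end Identities

/-! ### The homotopy formula on test functions. -/

section Homotopy

variable {n : ℕ} {K : Compacts (EuclideanSpace ℝ (Fin n))}

/-- The components of the homotopy operator, dual to the averaged Poincaré homotopy. -/
noncomputable def homotopyOp (hK : Convex ℝ (K : Set (EuclideanSpace ℝ (Fin n))))
    {c : EuclideanSpace ℝ (Fin n)} (hc : c ∈ K) (θ : 𝓓_{K}(EuclideanSpace ℝ (Fin n), ℝ))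
    (m : ℕ) (i : Fin n) :
    𝓓_{K}(EuclideanSpace ℝ (Fin n), ℝ) →L[ℝ] 𝓓_{K}(EuclideanSpace ℝ (Fin n), ℝ) :=
  (dilationOp hK (n - m - 1) θ).comp (coordMul c i) - dilationOp hK (n - m - 1) (coordMul c i θ)
    + (smoothingOp hK hc m θ).comp (coordMul c i)

/-- The scalar operator appearing in the commutator of `homotopyOp` and differentiation. -/
noncomputable def scalingOp (hK : Convex ℝ (K : Set (EuclideanSpace ℝ (Fin n))))
    {c : EuclideanSpace ℝ (Fin n)} (hc : c ∈ K) (θ : 𝓓_{K}(EuclideanSpace ℝ (Fin n), ℝ))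
    (m : ℕ) :
    𝓓_{K}(EuclideanSpace ℝ (Fin n), ℝ) →L[ℝ] 𝓓_{K}(EuclideanSpace ℝ (Fin n), ℝ) :=
  dilationOp hK (n - m - 1) θ + smoothingOp hK hc m θ

theorem homotopyOp_apply (hK : Convex ℝ (K : Set (EuclideanSpace ℝ (Fin n))))
    {c : EuclideanSpace ℝ (Fin n)} (hc : c ∈ K) (θ f : 𝓓_{K}(EuclideanSpace ℝ (Fin n), ℝ))
    (m : ℕ) (i : Fin n) :
    homotopyOp hK hc θ m i f = dilationOp hK (n - m - 1) θ (coordMul c i f)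
      - dilationOp hK (n - m - 1) (coordMul c i θ) f + smoothingOp hK hc m θ (coordMul c i f) :=
  rfl

/-- Differentiation lowers the degree index of both legs by one; `δ_ij` comes from differentiating
the factor `x_i - c_i`. -/
theorem dirDeriv_homotopyOp_succ (hK : Convex ℝ (K : Set (EuclideanSpace ℝ (Fin n))))
    {c : EuclideanSpace ℝ (Fin n)} (hc : c ∈ K) (θ f : 𝓓_{K}(EuclideanSpace ℝ (Fin n), ℝ))
    (m : ℕ) (i j : Fin n) :
    dirDeriv (EuclideanSpace.single j 1) (homotopyOp hK hc θ (m + 1) i f) =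
      (if i = j then scalingOp hK hc θ m f else 0)
        + homotopyOp hK hc θ m i (dirDeriv (EuclideanSpace.single j 1) f) := by
  have hβ : (n : ℝ) - (m + 1 : ℕ) - 1 + 1 = n - m - 1 := by push_cast; ring
  rw [homotopyOp_apply, map_add, map_sub, dirDeriv_dilationOp, dirDeriv_dilationOp,
    dirDeriv_smoothingOp, dirDeriv_coordMul, hβ, homotopyOp_apply]
  split_ifs
  · simp only [map_add, scalingOp, add_apply]
    abel
  · simp only [zero_add]

/-- The legs match at `s = 1/2`: substitute `x = 2y - a`. -/
theorem integral_average_eq (θ f : 𝓓_{K}(EuclideanSpace ℝ (Fin n), ℝ)) (m : ℕ)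
    (y : EuclideanSpace ℝ (Fin n)) :
    ∫ a in (K : Set (EuclideanSpace ℝ (Fin n))),
        θ a * (Real.exp (((n : ℝ) - m) * Real.log 2) * f ((2 : ℝ) • y - a)) =
      ∫ x in (K : Set (EuclideanSpace ℝ (Fin n))),
        f x * 2 ^ n * ((1 / 2) ^ m * θ ((2 : ℝ) • y - x)) := by
  have h : Real.exp (((n : ℝ) - m) * Real.log 2) = 2 ^ n * (1 / 2) ^ m := by
    rw [sub_mul, Real.exp_sub, mul_comm, mul_comm (m : ℝ), Real.exp_mul, Real.exp_mul,
      Real.exp_log two_pos, Real.rpow_natCast, Real.rpow_natCast]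
    simp [div_eq_mul_inv]
  rw [setIntegral_eq_integral_of_forall_compl_eq_zero
      (fun x hx => by rw [show θ x = 0 from θ.zero_on_compl hx, zero_mul]),
    setIntegral_eq_integral_of_forall_compl_eq_zero
      (fun x hx => by rw [show f x = 0 from f.zero_on_compl hx, zero_mul, zero_mul]),
    ← integral_sub_left_eq_self _ _ ((2 : ℝ) • y)]
  refine integral_congr_ae (Filter.Eventually.of_forall fun x => ?_)
  simp only [h, sub_sub_cancel]
  ring

/-- Adding the two endpoint formulas cancels the contributions at `s = 1/2`. What remains is `f` at
`s = 1` and, only for `m = 0`, the averaged constant map at `s = 0`. -/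
theorem sum_dirDeriv_homotopyOp (hK : Convex ℝ (K : Set (EuclideanSpace ℝ (Fin n))))
    {c : EuclideanSpace ℝ (Fin n)} (hc : c ∈ K) (θ f : 𝓓_{K}(EuclideanSpace ℝ (Fin n), ℝ))
    (hθ : ∫ x in (K : Set (EuclideanSpace ℝ (Fin n))), θ x = 1) (m : ℕ)
    (y : EuclideanSpace ℝ (Fin n)) :
    (m : ℝ) * (dilationOp hK (n - m) θ f y + smoothingOp hK hc (m - 1) θ f y)
      - ∑ i, dirDeriv (EuclideanSpace.single i 1) (homotopyOp hK hc θ m i f) y =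
    f y - 0 ^ m * ((∫ x in (K : Set (EuclideanSpace ℝ (Fin n))), f x)
      * (2 ^ n * θ ((2 : ℝ) • y - c))) := by
  have h1 := dilationOp_boundary hK (n - m) c θ f y
  have h2 := smoothingOp_boundary hK hc m θ f y
  have hβ : (n : ℝ) - m - 1 + 1 = n - m := by ring
  have h3 : ∫ x in (K : Set (EuclideanSpace ℝ (Fin n))),
      f x * 2 ^ n * ((1 / 2) ^ m * θ ((2 : ℝ) • y - x) - 0 ^ m * θ ((2 : ℝ) • y - c)) =
      (∫ x in (K : Set (EuclideanSpace ℝ (Fin n))),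
        f x * 2 ^ n * ((1 / 2) ^ m * θ ((2 : ℝ) • y - x))) -
      (∫ x in (K : Set (EuclideanSpace ℝ (Fin n))), f x) *
        (2 ^ n * (0 ^ m * θ ((2 : ℝ) • y - c))) := by
    have hθc := continuous_coe θ
    have hfc := continuous_coe f
    rw [← integral_mul_const, ← integral_sub]
    · refine integral_congr_ae (Filter.Eventually.of_forall fun x => ?_)
      simp only
      ring
    · exact Continuous.continuousOn (by fun_prop) |>.integrableOn_compact K.isCompact
    · exact Continuous.continuousOn (by fun_prop) |>.integrableOn_compact K.isCompact
  rw [hθ, integral_average_eq] at h1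
  rw [h3] at h2
  simp only [homotopyOp_apply, map_add, map_sub, dirDeriv_dilationOp, add_apply, sub_apply,
    Finset.sum_add_distrib, Finset.sum_sub_distrib, hβ]
  linear_combination h1 + h2

theorem sum_dirDeriv_homotopyOp_succ (hK : Convex ℝ (K : Set (EuclideanSpace ℝ (Fin n))))
    {c : EuclideanSpace ℝ (Fin n)} (hc : c ∈ K) (θ f : 𝓓_{K}(EuclideanSpace ℝ (Fin n), ℝ))
    (hθ : ∫ x in (K : Set (EuclideanSpace ℝ (Fin n))), θ x = 1) (m : ℕ) :
    (m + 1 : ℝ) • scalingOp hK hc θ m f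
      - ∑ i, dirDeriv (EuclideanSpace.single i 1) (homotopyOp hK hc θ (m + 1) i f) = f := by
  ext y
  have h := sum_dirDeriv_homotopyOp hK hc θ f hθ (m + 1) y
  have hβ : (n : ℝ) - (m + 1 : ℕ) = n - m - 1 := by push_cast; ring
  rw [hβ, Nat.add_sub_cancel, pow_succ, mul_zero, zero_mul, sub_zero] at h
  push_cast at h
  simpa [scalingOp, sum_apply, mul_add] using h

theorem homotopyOp_eq_zero (hK : Convex ℝ (K : Set (EuclideanSpace ℝ (Fin n))))
    {c : EuclideanSpace ℝ (Fin n)} (hc : c ∈ K) {θ f : 𝓓_{K}(EuclideanSpace ℝ (Fin n), ℝ)}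
    {C : Set (EuclideanSpace ℝ (Fin n))} (hC : Convex ℝ C) (hcC : c ∈ C)
    (hθ : ∀ x ∉ C, θ x = 0) (hf : ∀ x ∉ C, f x = 0) (m : ℕ) (i : Fin n)
    {y : EuclideanSpace ℝ (Fin n)} (hy : y ∉ C) : homotopyOp hK hc θ m i f y = 0 := by
  have hf' : ∀ x ∉ C, coordMul c i f x = 0 := fun x hx => by
    rw [coordMul_apply, hf x hx, zero_mul]
  have hθ' : ∀ x ∉ C, coordMul c i θ x = 0 := fun x hx => by
    rw [coordMul_apply, hθ x hx, zero_mul]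
  rw [homotopyOp_apply, add_apply, sub_apply, dilationOp_apply, dilationOp_apply,
    smoothingOp_apply,
    setIntegral_eq_zero_of_forall_eq_zero fun z hz =>
      dilationKernel_eq_zero _ hC hf' (hθ _) hz.2.1 hy,
    setIntegral_eq_zero_of_forall_eq_zero fun z hz =>
      dilationKernel_eq_zero _ hC hf (hθ' _) hz.2.1 hy,
    setIntegral_eq_zero_of_forall_eq_zero fun z hz =>
      smoothingKernel_eq_zero _ hC hcC hθ (hf' _) hz.2 hy]
  simp

end Homotopy

/-! ### Exterior algebra: contraction against `dx_i ∧`. -/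

section Contraction

variable {𝕜 : Type*} [RCLike 𝕜] {n : ℕ}

/-- Contraction of a form with a vector, in the first slot. -/
noncomputable def contract (k : ℕ) (v : EuclideanSpace ℝ (Fin n)) :
    Form 𝕜 n (k + 1) →L[ℝ] Form 𝕜 n k :=
  (ContinuousLinearMap.apply ℝ (Form 𝕜 n k) v).comp
    (ContinuousAlternatingMap.curryLeftLI (𝕜 := ℝ) (E := EuclideanSpace ℝ (Fin n)) (F := 𝕜)
      (n := k)).toContinuousLinearMap

theorem contract_apply (k : ℕ) (v : EuclideanSpace ℝ (Fin n)) (η : Form 𝕜 n (k + 1))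
    (w : Fin k → EuclideanSpace ℝ (Fin n)) : contract k v η w = η (Matrix.vecCons v w) :=
  rfl

theorem dxWedge_apply (k : ℕ) (i : Fin n) (η : Form 𝕜 n k)
    (w : Fin (k + 1) → EuclideanSpace ℝ (Fin n)) :
    dxWedge 𝕜 k i η w = ∑ m : Fin (k + 1), (-1) ^ (m : ℕ) • (w m i • η (m.removeNth w)) := by
  simp [dxWedge, ContinuousAlternatingMap.alternatizeUncurryFin_apply]

theorem contract_dxWedge_zero (i j : Fin n) (η : Form 𝕜 n 0) :
    contract 0 (EuclideanSpace.single i 1) (dxWedge 𝕜 0 j η) = if i = j then η else 0 := by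
  ext w
  rw [contract_apply, dxWedge_apply]
  by_cases h : i = j
  · subst h
    simp
  · simp [h, Ne.symm h]

/-- Contraction is an antiderivation: the summand `m = 0` of the wedge gives `δ_ij η`, the others
change sign by the index shift. -/
theorem contract_dxWedge (k : ℕ) (i j : Fin n) (η : Form 𝕜 n (k + 1)) :
    contract (k + 1) (EuclideanSpace.single i 1) (dxWedge 𝕜 (k + 1) j η) =
      (if i = j then η else 0) - dxWedge 𝕜 k j (contract k (EuclideanSpace.single i 1) η) := by
  ext w
  rw [contract_apply, dxWedge_apply, Fin.sum_univ_succ, sub_eq_add_neg,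
    ContinuousAlternatingMap.add_apply, ContinuousAlternatingMap.neg_apply, dxWedge_apply,
    ← Finset.sum_neg_distrib]
  congr 1
  · by_cases h : i = j
    · subst h
      simp [Fin.tail_def]
    · simp [h, Ne.symm h]
  · refine Finset.sum_congr rfl fun m _ => ?_
    rw [contract_apply]
    have : m.succ.removeNth (Matrix.vecCons (EuclideanSpace.single i (1 : ℝ)) w) =
        Matrix.vecCons (EuclideanSpace.single i (1 : ℝ)) (m.removeNth w) := by
      ext l : 1
      refine Fin.cases ?_ (fun l => ?_) l <;> simp [Fin.removeNth]
    rw [this]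
    simp [pow_succ]

theorem sum_dxWedge_contract (k : ℕ) (η : Form 𝕜 n (k + 1)) :
    ∑ i, dxWedge 𝕜 k i (contract k (EuclideanSpace.single i 1) η) = (k + 1 : ℝ) • η := by
  have h : ∑ i, (EuclideanSpace.proj i : EuclideanSpace ℝ (Fin n) →L[ℝ] ℝ).smulRight
      (contract k (EuclideanSpace.single i 1) η) = η.curryLeft := by
    ext1 v
    conv_rhs => rw [← (EuclideanSpace.basisFun (Fin n) ℝ).sum_repr v]
    simp [sum_apply]
    rfl
  have h2 := ContinuousAlternatingMap.alternatizeUncurryFin_curryLeft (𝕜 := ℝ) η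
  rw [← h, ← ContinuousAlternatingMap.alternatizeUncurryFinCLM_apply, map_sum] at h2
  rw [← Nat.cast_smul_eq_nsmul ℝ] at h2
  push_cast at h2
  exact h2

end Contraction

/-! ### Convexity, bump functions and supports in the simplex. -/

section Simplex

variable {n : ℕ}

theorem convex_simplexSet (n : ℕ) : Convex ℝ (simplexSet n) := by
  intro x hx y hy a b ha hb hab
  have hsum : ∑ i, (a • x + b • y) i = a * ∑ i, x i + b * ∑ i, y i := by
    simp [Finset.sum_add_distrib, Finset.mul_sum]
  refine ⟨fun i => ?_, ?_⟩
  · have h1 := hx.1 i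
    have h2 := hy.1 i
    simp only [PiLp.add_apply, PiLp.smul_apply, smul_eq_mul]
    constructor <;> nlinarith
  · rw [hsum]
    have h1 := hx.2
    have h2 := hy.2
    constructor <;> nlinarith

theorem nonempty_openSimplex (n : ℕ) :
    (openSimplex n : Set (EuclideanSpace ℝ (Fin n))).Nonempty := by
  have hopen : IsOpen {x : EuclideanSpace ℝ (Fin n) | (∀ i, 0 < x i) ∧ ∑ i, x i < 1} := by
    rw [ofPred_and, ofPred_forall]
    exact (isOpen_iInter_of_finite fun i => isOpen_lt (by fun_prop) (by fun_prop)).inter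
      (isOpen_lt (by fun_prop) (by fun_prop))
  have hsub : {x : EuclideanSpace ℝ (Fin n) | (∀ i, 0 < x i) ∧ ∑ i, x i < 1} ⊆ simplexSet n := by
    rintro x ⟨h0, h1⟩
    refine ⟨fun i => ⟨(h0 i).le, ?_⟩, Finset.sum_nonneg fun i _ => (h0 i).le, h1.le⟩
    exact (Finset.single_le_sum (fun j _ => (h0 j).le) (Finset.mem_univ i)).trans h1.le
  refine ⟨WithLp.toLp 2 fun _ => 1 / (n + 1 : ℝ), interior_maximal hsub hopen ⟨fun i => ?_, ?_⟩⟩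
  · positivity
  · simp only [Finset.sum_const, Finset.card_univ, Fintype.card_fin, nsmul_eq_mul]
    rw [mul_one_div, div_lt_one (by positivity)]
    linarith

/-- Each point of `S` is interior to the hull of a finite subset of `Ω`. By compactness finitely
many such sets suffice, and the hull of their union is compact. -/
theorem exists_isCompact_convex_between {Ω S : Set (EuclideanSpace ℝ (Fin n))} (hΩ : IsOpen Ω)
    (hconv : Convex ℝ Ω) (hS : IsCompact S) (hSΩ : S ⊆ Ω) :
    ∃ C, IsCompact C ∧ Convex ℝ C ∧ S ⊆ C ∧ C ⊆ Ω := by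
  suffices h : ∃ u : Set (EuclideanSpace ℝ (Fin n)), u.Finite ∧ u ⊆ Ω ∧ S ⊆ convexHull ℝ u by
    obtain ⟨u, hu, huΩ, hSu⟩ := h
    exact ⟨convexHull ℝ u, hu.isCompact_convexHull ℝ, convex_convexHull ℝ u, hSu,
      convexHull_min huΩ hconv⟩
  refine hS.induction_on ⟨∅, finite_empty, empty_subset _, empty_subset _⟩ ?_ ?_ ?_
  · rintro s t hst ⟨u, hu, huΩ, htu⟩
    exact ⟨u, hu, huΩ, hst.trans htu⟩
  · rintro s t ⟨u, hu, huΩ, hsu⟩ ⟨v, hv, hvΩ, htv⟩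
    exact ⟨u ∪ v, hu.union hv, union_subset huΩ hvΩ,
      union_subset (hsu.trans (convexHull_mono subset_union_left))
        (htv.trans (convexHull_mono subset_union_right))⟩
  · intro x hx
    have hxΩ : Ω ∈ nhdsSet {x} := by rw [nhdsSet_singleton]; exact hΩ.mem_nhds (hSΩ hx)
    obtain ⟨u, hxu, huΩ⟩ :=
      (convex_singleton x).exists_subset_interior_convexHull_finset_of_isCompact
        isCompact_singleton hxΩ
    exact ⟨_, mem_nhdsWithin_of_mem_nhds (mem_interior_iff_mem_nhds.1 (singleton_subset_iff.1 hxu)),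
      u, u.finite_toSet, (subset_convexHull ℝ _).trans huΩ, subset_rfl⟩

theorem exists_testFunction_integral_eq_one (n : ℕ) :
    ∃ θ : 𝓓(openSimplex n, ℝ), ∫ x, θ x = 1 := by
  obtain ⟨c, hc⟩ := nonempty_openSimplex n
  obtain ⟨f, hfs, hfc, hf, hf01, hf1⟩ := exists_contDiff_tsupport_subset (n := ⊤)
    ((openSimplex n).isOpen.mem_nhds hc)
  have hpos : 0 < ∫ x, f x :=
    hf.continuous.integral_pos_of_hasCompactSupport_nonneg_nonzero hfc
      (fun x => (hf01 (mem_range_self x)).1) (x := c) (by rw [hf1]; exact one_ne_zero)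
  refine ⟨(∫ x, f x)⁻¹ • (⟨f, hf, hfc, hfs⟩ : 𝓓(openSimplex n, ℝ)), ?_⟩
  simp only [smul_apply, smul_eq_mul, TestFunction.coe_mk]
  rw [integral_const_mul, inv_mul_cancel₀ hpos.ne']

theorem toSupportedIn_apply (φ : 𝓓(openSimplex n, ℝ)) (x : EuclideanSpace ℝ (Fin n)) :
    toSupportedIn φ x = φ x :=
  rfl

theorem setIntegral_simplex_eq (f : 𝓓_{simplex n}(EuclideanSpace ℝ (Fin n), ℝ)) :
    ∫ x in (simplex n : Set (EuclideanSpace ℝ (Fin n))), f x = ∫ x, f x :=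
  setIntegral_eq_integral_of_forall_compl_eq_zero fun _ hx => f.zero_on_compl hx

theorem toSupportedIn_lineDeriv (v : EuclideanSpace ℝ (Fin n)) (φ : 𝓓(openSimplex n, ℝ)) :
    toSupportedIn (∂_{v} φ) = dirDeriv v (toSupportedIn φ) := by
  ext y
  rw [dirDeriv_apply, toSupportedIn_apply, TestFunction.lineDerivOp_eq_lineDerivCLM ℝ,
    TestFunction.lineDerivCLM_apply_of_le (by simp)]
  exact ((φ.contDiff.differentiable (by simp)) y).lineDeriv_eq_fderiv

theorem exists_toSupportedIn_eq {C : Set (EuclideanSpace ℝ (Fin n))} (hC : IsCompact C)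
    (hCΩ : C ⊆ openSimplex n) (f : 𝓓_{simplex n}(EuclideanSpace ℝ (Fin n), ℝ))
    (hf : ∀ x ∉ C, f x = 0) : ∃ χ : 𝓓(openSimplex n, ℝ), toSupportedIn χ = f := by
  have hsupp : tsupport f ⊆ C := closure_minimal
    (fun x hx => by by_contra h; exact hx (hf x h)) hC.isClosed
  exact ⟨⟨f, f.contDiff, f.compact_supp, hsupp.trans hCΩ⟩, rfl⟩

/-- Makes the homotopy of a test function admissible in the closedness condition on `u`. -/
theorem exists_toSupportedIn_eq_homotopyOp {c : EuclideanSpace ℝ (Fin n)} (hc : c ∈ simplex n)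
    (hcΩ : c ∈ openSimplex n) (θ φ : 𝓓(openSimplex n, ℝ)) (m : ℕ) (i : Fin n) :
    ∃ χ : 𝓓(openSimplex n, ℝ), toSupportedIn χ =
      homotopyOp (convex_simplexSet n) hc (toSupportedIn θ) m i (toSupportedIn φ) := by
  obtain ⟨C, hC, hconv, hSC, hCΩ⟩ := exists_isCompact_convex_between (openSimplex n).isOpen
    (convex_simplexSet n).interior
    ((θ.hasCompactSupport.isCompact.union φ.hasCompactSupport.isCompact).union
      (isCompact_singleton (x := c)))
    (union_subset (union_subset θ.tsupport_subset φ.tsupport_subset) (singleton_subset_iff.2 hcΩ))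
  refine exists_toSupportedIn_eq hC hCΩ _ fun y hy =>
    homotopyOp_eq_zero _ hc hconv (hSC (Or.inr rfl)) (fun x hx => ?_) (fun x hx => ?_) m i hy
  · exact image_eq_zero_of_notMem_tsupport fun h => hx (hSC (Or.inl (Or.inl h)))
  · exact image_eq_zero_of_notMem_tsupport fun h => hx (hSC (Or.inl (Or.inr h)))

end Simplex

/-! ### The primitive in positive degree and constancy in degree zero. -/

section Current

variable {𝕜 : Type*} [RCLike 𝕜] {n k : ℕ}

/-- The extendible current given by a continuous linear functional on the smooth functions
supported in the simplex. -/
noncomputable def ofFunctional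
    (T : 𝓓_{simplex n}(EuclideanSpace ℝ (Fin n), ℝ) →L[ℝ] Form 𝕜 n k) :
    Current 𝕜 (openSimplex n) k :=
  TestFunction.mkCLM ℝ (fun φ => T (toSupportedIn φ))
    (fun φ ψ => T.map_add (toSupportedIn φ) (toSupportedIn ψ))
    (fun r φ => T.map_smul r (toSupportedIn φ)) fun L hL => by
      -- Continuity is tested on each compact `L` in the interior, where the map factors through the
      -- inclusion into functions supported in the simplex.
      have h : ((fun φ => T (toSupportedIn φ)) ∘ TestFunction.ofSupportedIn hL :
          𝓓_{L}(EuclideanSpace ℝ (Fin n), ℝ) → Form 𝕜 n k) =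
          T.comp (ContDiffMapSupportedIn.monoCLM ℝ) := by
        funext f
        change T _ = T (ContDiffMapSupportedIn.monoCLM ℝ f)
        congr 1
        ext x
        rw [ContDiffMapSupportedIn.monoCLM_apply,
          if_pos ⟨le_rfl, hL.trans interior_subset⟩]
        rfl
      rw [h]
      exact ContinuousLinearMap.continuous _

theorem ofFunctional_apply
    (T : 𝓓_{simplex n}(EuclideanSpace ℝ (Fin n), ℝ) →L[ℝ] Form 𝕜 n k)
    (φ : 𝓓(openSimplex n, ℝ)) : ofFunctional T φ = T (toSupportedIn φ) :=
  rfl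

theorem extDeriv_apply {Ω : Opens (EuclideanSpace ℝ (Fin n))} (u : Current 𝕜 Ω k)
    (φ : 𝓓(Ω, ℝ)) :
    extDeriv u φ = - ∑ i, dxWedge 𝕜 k i (u (∂_{EuclideanSpace.single i (1 : ℝ)} φ)) := by
  rw [extDeriv, sum_apply, ← Finset.sum_neg_distrib]
  refine Finset.sum_congr rfl fun i _ => ?_
  rw [Distribution.mapCLM_apply, Distribution.lineDerivOp_apply_apply, map_neg, map_neg]

theorem sum_dxWedge_of_closed {u : Current 𝕜 (openSimplex n) k}
    {T : 𝓓_{simplex n}(EuclideanSpace ℝ (Fin n), ℝ) →L[ℝ] Form 𝕜 n k}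
    (hT : ∀ φ : 𝓓(openSimplex n, ℝ), u φ = T (toSupportedIn φ)) (hu : extDeriv u = 0)
    (χ : 𝓓(openSimplex n, ℝ)) :
    ∑ j, dxWedge 𝕜 k j (T (dirDeriv (EuclideanSpace.single j 1) (toSupportedIn χ))) = 0 := by
  have h := extDeriv_apply u χ
  rw [hu, zero_apply, eq_comm, neg_eq_zero] at h
  simpa only [hT, toSupportedIn_lineDeriv] using h

theorem exists_extendible_primitive (u : Current 𝕜 (openSimplex n) (k + 1))
    (hext : IsExtendible u) (hu : extDeriv u = 0) :
    ∃ v : Current 𝕜 (openSimplex n) k, IsExtendible v ∧ u = extDeriv v := by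
  obtain ⟨T, hT⟩ := hext
  obtain ⟨c, hcΩ⟩ := nonempty_openSimplex n
  have hc : c ∈ simplex n := interior_subset hcΩ
  obtain ⟨θ, hθ⟩ := exists_testFunction_integral_eq_one n
  let H (m : ℕ) (i : Fin n) := homotopyOp (convex_simplexSet n) hc (toSupportedIn θ) m i
  let V : 𝓓_{simplex n}(EuclideanSpace ℝ (Fin n), ℝ) →L[ℝ] Form 𝕜 n k :=
    ∑ i, (contract k (EuclideanSpace.single i 1)).comp (T.comp (H k i))
  refine ⟨ofFunctional V, ⟨V, ofFunctional_apply V⟩, ?_⟩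
  ext1 φ
  rw [extDeriv_apply]
  set f := toSupportedIn φ with hf
  let e (i : Fin n) : EuclideanSpace ℝ (Fin n) := EuclideanSpace.single i 1
  let J := scalingOp (convex_simplexSet n) hc (toSupportedIn θ) k f
  -- Closedness tested on `H_{k+1,i} f` and contracted with `e_i`. Summed over `i` and commuted, it
  -- gives `∑ T(∂_i H_{k+1,i} f) = (k+1) T(J f) + ∑ dx_j ∧ V(∂_j f)`.
  have hclosed : ∀ i, T (dirDeriv (e i) (H (k + 1) i f)) =
      ∑ j, dxWedge 𝕜 k j (contract k (e i) (T (dirDeriv (e j) (H (k + 1) i f)))) := fun i => by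
    obtain ⟨χ, hχ⟩ := exists_toSupportedIn_eq_homotopyOp hc hcΩ θ φ (k + 1) i
    have h := congrArg (contract (k + 1) (e i)) (sum_dxWedge_of_closed hT hu χ)
    rw [hχ, map_sum, map_zero] at h
    simp only [e, contract_dxWedge, Finset.sum_sub_distrib, Finset.sum_ite_eq, Finset.mem_univ,
      if_true] at h
    exact sub_eq_zero.1 h
  have hcomm : ∀ i j, contract k (e i) (T (dirDeriv (e j) (H (k + 1) i f))) =
      (if i = j then contract k (e i) (T J) else 0)
        + contract k (e i) (T (H k i (dirDeriv (e j) f))) := fun i j => by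
    rw [show dirDeriv (e j) (H (k + 1) i f) = _ from dirDeriv_homotopyOp_succ _ hc _ f k i j,
      map_add, map_add]
    congr 1
    split_ifs
    · rfl
    · rw [map_zero, map_zero]
  have hsum := congrArg T (sum_dirDeriv_homotopyOp_succ (convex_simplexSet n) hc
    (toSupportedIn θ) f (by rw [setIntegral_simplex_eq]; exact hθ) k)
  rw [map_sub, map_smul, map_sum, Finset.sum_congr rfl fun i _ => hclosed i] at hsum
  simp only [hcomm, map_add, Finset.sum_add_distrib, apply_ite (dxWedge 𝕜 k _), map_zero,
    Finset.sum_ite_eq, Finset.mem_univ, if_true] at hsum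
  rw [show ∑ i, dxWedge 𝕜 k i (contract k (e i) (T J)) = _ from sum_dxWedge_contract k (T J),
    Finset.sum_comm] at hsum
  have hV : ∀ j, ofFunctional V (∂_{EuclideanSpace.single j (1 : ℝ)} φ) =
      ∑ i, contract k (e i) (T (H k i (dirDeriv (e j) f))) := fun j => by
    rw [ofFunctional_apply, toSupportedIn_lineDeriv]
    simp only [V, sum_apply]
    rfl
  simp only [hV, map_sum]
  rw [hT φ, ← hf, ← hsum]
  simp only [J]
  abel

theorem isConstant_of_closed (u : Current 𝕜 (openSimplex n) 0)
    (hext : IsExtendible u) (hu : extDeriv u = 0) : IsConstant u := by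
  obtain ⟨T, hT⟩ := hext
  obtain ⟨c, hcΩ⟩ := nonempty_openSimplex n
  have hc : c ∈ simplex n := interior_subset hcΩ
  obtain ⟨θ, hθ⟩ := exists_testFunction_integral_eq_one n
  -- The density of `(a + c) / 2` when `a` has density `θ`, that is, the endpoint `s = 0`; the
  -- constant is `T g`.
  let g : 𝓓_{simplex n}(EuclideanSpace ℝ (Fin n), ℝ) :=
    { toFun := fun y => 2 ^ n * toSupportedIn θ ((2 : ℝ) • y - c)
      contDiff' := contDiff_const.mul ((toSupportedIn θ).contDiff.comp (by fun_prop))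
      zero_on_compl' := fun y hy => by
        simp only [Pi.zero_apply]
        rw [show toSupportedIn θ ((2 : ℝ) • y - c) = 0 from
          (toSupportedIn θ).zero_on_compl fun h => hy ?_, mul_zero]
        have := convex_simplexSet n h hc (by norm_num : (0 : ℝ) ≤ 1 / 2)
          (by norm_num : (0 : ℝ) ≤ 1 / 2) (by norm_num)
        rwa [show (1 / 2 : ℝ) • ((2 : ℝ) • y - c) + (1 / 2 : ℝ) • c = y by module] at this }
  refine ⟨T g 0, fun φ => ?_⟩
  set f := toSupportedIn φ with hf
  have hsum : f - (∫ x, φ x) • g = - ∑ i, dirDeriv (EuclideanSpace.single i 1)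
      (homotopyOp (convex_simplexSet n) hc (toSupportedIn θ) 0 i f) := by
    ext y
    have h := sum_dirDeriv_homotopyOp (convex_simplexSet n) hc (toSupportedIn θ) f
      (by rw [setIntegral_simplex_eq]; exact hθ) 0 y
    rw [setIntegral_simplex_eq, Nat.cast_zero, zero_mul, zero_sub, pow_zero, one_mul] at h
    rw [neg_apply, sum_apply]
    exact h.symm
  have hzero : ∀ i, T (dirDeriv (EuclideanSpace.single i 1)
      (homotopyOp (convex_simplexSet n) hc (toSupportedIn θ) 0 i f)) = 0 := fun i => by
    obtain ⟨χ, hχ⟩ := exists_toSupportedIn_eq_homotopyOp hc hcΩ θ φ 0 i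
    have h := congrArg (contract 0 (EuclideanSpace.single i 1)) (sum_dxWedge_of_closed hT hu χ)
    rw [hχ, map_sum, map_zero] at h
    simpa only [contract_dxWedge_zero, Finset.sum_ite_eq, Finset.mem_univ, if_true] using h
  have h := congrArg T hsum
  rw [map_sub, map_smul, map_neg, map_sum, Finset.sum_eq_zero fun i _ => hzero i, neg_zero,
    sub_eq_zero] at h
  rw [hT φ, ← hf, h]
  congr 1
  ext w
  rw [Subsingleton.elim w 0]
  rfl

end Current

end ExtendibleCurrent

theorem lemma11p11p1999p1 (𝕜 : Type*) [RCLike 𝕜] (n : ℕ) :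
    (∀ (k : ℕ) (u : ExtendibleCurrent.Current 𝕜 (ExtendibleCurrent.openSimplex n) (k + 1)),
      ExtendibleCurrent.IsExtendible u → ExtendibleCurrent.extDeriv u = 0 →
      ∃ v : ExtendibleCurrent.Current 𝕜 (ExtendibleCurrent.openSimplex n) k,
        ExtendibleCurrent.IsExtendible v ∧ u = ExtendibleCurrent.extDeriv v) ∧
    (∀ u : ExtendibleCurrent.Current 𝕜 (ExtendibleCurrent.openSimplex n) 0,
      ExtendibleCurrent.IsExtendible u → ExtendibleCurrent.extDeriv u = 0 →
      ExtendibleCurrent.IsConstant u) :=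
  ⟨fun _ => ExtendibleCurrent.exists_extendible_primitive,
    ExtendibleCurrent.isConstant_of_closed⟩
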